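/- Let $L/K$ be a finite separable field extension, let $\widetilde L$ be its Galois (normal) closure, $G=\mathrm{Gal}(\widetilde L/K)$ and $G'=\mathrm{Gal}(\widetilde L/L)$. A Hopf Galois structure on $L/K$ is a pair $(H,\mu)$, where $H$ is a finite cocommutative $K$-Hopf algebra and $\mu:H\to \mathrm{End}_K(L)$ is a $K$-linear map which makes $L$ a left $H$-module algebra and induces a $K$-vector space isomorphism $L\otimes_K H\to \mathrm{End}_K(L)$. By a theorem of Greither and Pareigis, the Hopf Galois structures on $L/K$ (up to isomorphism) correspond bijectively to the regular subgroups $N$ of $\mathrm{Sym}(G/G')$ normalized by $\lambda(G)$, where $\lambda$ is the action of $G$ on $G/G'$ by left translation: to $N$ corresponds the Hopf algebra $\widetilde L[N]^G$ ($G$ acting on $\widetilde L$ as Galois group and on $N$ by conjugation through $\lambda$), acting on $L$ by $\left(\sum_{n} c_n n\right)\cdot x=\sum_n c_n\,\bigl(n^{-1}(\bar 1)\bigr)(x)$, where $\bar 1$ is the class of $1$ in $G/G'$ and a coset $gG'$ sends $x\in L$ to $g(x)\in\widetilde L$. The type of a Hopf Galois structure is the isomorphism class of the corresponding group $N$. Theorem.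 Let $p$ be an odd prime and let $L/K$ be a separable field extension of degree $2p^2$. If $L/K$ has a Hopf Galois structure of type $C_p\times C_{2p}$ or of type $C_p\times D_{2p}$ (where $D_{2p}$ is the dihedral group of order $2p$), then $L/K$ has a Hopf Galois structure of type $(C_p\times C_p)\rtimes C_2$, where the generator of $C_2$ acts on $C_p\times C_p$ by inversion. -/

import Mathlib

open scoped TensorProduct

noncomputable section

/-! ### Hopf Galois structures -/

/-- A Hopf Galois structure on `L / K`: a finite cocommutative `K`-Hopf algebra `H` and a `K`-linear
map `μ : H → End_K(L)` which makes `L` a left `H`-module algebra and for which the `K`-linear map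
`L ⊗ H → End_K(L)`, `x ⊗ h ↦ (y ↦ x * μ h y)`, is bijective. -/
structure HopfGaloisStructure.{t, u, v} (K : Type u) (L : Type v) [Field K] [Field L]
    [Algebra K L] where
  /-- The underlying type of the Hopf algebra. -/
  H : Type t
  [ring : Ring H]
  [hopfAlgebra : HopfAlgebra K H]
  [finite : Module.Finite K H]
  [cocomm : Coalgebra.IsCocomm K H]
  /-- The action; being an algebra homomorphism, it makes `L` a left `H`-module. -/
  μ : H →ₐ[K] Module.End K L
  /-- `h · 1 = ε(h) 1`. -/
  map_one' : ∀ h : H, μ h 1 = algebraMap K L (Coalgebra.counit h)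
  /-- `h · (x y) = ∑ (h₁ · x) (h₂ · y)`. -/
  map_mul' : ∀ (h : H) (x y : L), μ h (x * y) =
    LinearMap.mul' K L
      (TensorProduct.map (μ.toLinearMap.flip x) (μ.toLinearMap.flip y) (Coalgebra.comul h))
  /-- In `End_K(L)`, the product of (multiplication by `x`) and `μ h` is `y ↦ x * μ h y`. -/
  bijective : Function.Bijective
    (TensorProduct.lift ((LinearMap.mul K (Module.End K L)).compl₁₂
      (Algebra.lmul K L).toLinearMap μ.toLinearMap) : L ⊗[K] H →ₗ[K] Module.End K L)

attribute [instance] HopfGaloisStructure.ring HopfGaloisStructure.hopfAlgebra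
  HopfGaloisStructure.finite HopfGaloisStructure.cocomm

namespace HopfGaloisStructure

/-! ### The coset space of the Galois group

Here `E` is the Galois closure of `L / K`, `G = Gal(E/K) = (E ≃ₐ[K] E)` and `G' = Gal(E/L)`, viewed
as the subgroup of `G` which fixes the image of `L` in `E`. -/

section Cosets

variable (K L E : Type*) [Field K] [Field L] [Field E] [Algebra K L] [Algebra K E] [Algebra L E]
  [IsScalarTower K L E]

/-- `G' = Gal(E/L)` as a subgroup of `G = Gal(E/K)`. -/
abbrev galoisSubgroup : Subgroup (E ≃ₐ[K] E) :=
  (IsScalarTower.toAlgHom K L E).fieldRange.fixingSubgroup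

/-- The set `G / G'` of left cosets. -/
abbrev GaloisCosets : Type _ := (E ≃ₐ[K] E) ⧸ galoisSubgroup K L E

/-- `λ : G → Sym(G / G')`, the action by left translation on left cosets. -/
abbrev leftTranslation : (E ≃ₐ[K] E) →* Equiv.Perm (GaloisCosets K L E) :=
  MulAction.toPermHom (E ≃ₐ[K] E) (GaloisCosets K L E)

variable {K L E}

/-- The value `g(x)` of a coset `g G'` at an element `x` of `L`. -/
def cosetEval (c : GaloisCosets K L E) (x : L) : E :=
  Quotient.liftOn' c (fun g => g (algebraMap L E x)) fun a b hab => by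
    have h := (IntermediateField.mem_fixingSubgroup_iff _ _).1 (QuotientGroup.leftRel_apply.1 hab)
      (algebraMap L E x) ⟨x, rfl⟩
    have h' := congrArg a h
    rw [← AlgEquiv.mul_apply, mul_inv_cancel_left] at h'
    exact h'.symm

theorem cosetEval_mk (g : E ≃ₐ[K] E) (x : L) :
    cosetEval (QuotientGroup.mk g : GaloisCosets K L E) x = g (algebraMap L E x) := rfl

end Cosets

/-- A subgroup `N` of `Sym(X)` is regular if it acts simply transitively on `X`. -/
def IsRegularSubgroup {X : Type*} (N : Subgroup (Equiv.Perm X)) : Prop :=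
  ∀ x y : X, ∃! n : N, (n : Equiv.Perm X) x = y

/-! ### The Hopf algebra attached to a regular subgroup normalized by `λ(G)` -/

section Correspondence

variable {K L E : Type*} [Field K] [Field L] [Field E] [Algebra K L] [Algebra K E] [Algebra L E]
  [IsScalarTower K L E]

/-- If `N` is normalized by `λ(G)`, then `g ∈ G` acts on `N` by conjugation by `λ(g)`. -/
def conj (N : Subgroup (Equiv.Perm (GaloisCosets K L E)))
    (hN : (leftTranslation K L E).range ≤ Subgroup.normalizer (N : Set _)) (g : E ≃ₐ[K] E) :
    N →* N where
  toFun n := ⟨leftTranslation K L E g * n * (leftTranslation K L E g)⁻¹,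
    (hN ⟨g, rfl⟩ n.1).1 n.2⟩
  map_one' := by ext; simp
  map_mul' a b := by ext; simp

/-- `g ∈ G` acts on `E[N]` by `∑ cₙ n ↦ ∑ g(cₙ) λ(g) n λ(g)⁻¹`. -/
def galoisAct (N : Subgroup (Equiv.Perm (GaloisCosets K L E)))
    (hN : (leftTranslation K L E).range ≤ Subgroup.normalizer (N : Set _)) (g : E ≃ₐ[K] E) :
    MonoidAlgebra E N →ₐ[K] MonoidAlgebra E N :=
  { (MonoidAlgebra.mapDomainRingHom E (conj N hN g)).comp
      (MonoidAlgebra.mapRingHom N (g : E →+* E)) with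
    commutes' := fun r => by simp }

theorem galoisAct_single (N : Subgroup (Equiv.Perm (GaloisCosets K L E)))
    (hN : (leftTranslation K L E).range ≤ Subgroup.normalizer (N : Set _)) (g : E ≃ₐ[K] E)
    (n : N) (c : E) :
    galoisAct N hN g (MonoidAlgebra.single n c) = MonoidAlgebra.single (conj N hN g n) (g c) := by
  change (MonoidAlgebra.mapDomainRingHom E (conj N hN g))
    (MonoidAlgebra.mapRingHom N (g : E →+* E) (MonoidAlgebra.single n c)) = _
  simp

/-- The `K`-subalgebra `E[N]^G` of `E[N]`. -/
def fixedSubalgebra (N : Subgroup (Equiv.Perm (GaloisCosets K L E)))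
    (hN : (leftTranslation K L E).range ≤ Subgroup.normalizer (N : Set _)) :
    Subalgebra K (MonoidAlgebra E N) :=
  ⨅ g : E ≃ₐ[K] E, AlgHom.equalizer (galoisAct N hN g) (AlgHom.id K (MonoidAlgebra E N))

theorem mem_fixedSubalgebra (N : Subgroup (Equiv.Perm (GaloisCosets K L E)))
    (hN : (leftTranslation K L E).range ≤ Subgroup.normalizer (N : Set _))
    (a : MonoidAlgebra E N) :
    a ∈ fixedSubalgebra N hN ↔ ∀ g : E ≃ₐ[K] E, galoisAct N hN g a = a := by
  simp [fixedSubalgebra, Algebra.mem_iInf]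

/-- The Hopf Galois structure `S` is, up to isomorphism, the one attached to `N`: its Hopf algebra
`H` is identified with `E[N]^G`, the comultiplication and the counit of `H` being restricted from
those of the group algebra `E[N]` over `E`, and its action being induced by `n ↦ n⁻¹(1̄)`, that is,
`(∑ cₙ n) · x = ∑ cₙ (n⁻¹(1̄))(x)` for `x` in `L`, where `1̄` is the coset of `1`. -/
def CorrespondsTo (S : HopfGaloisStructure K L)
    (N : Subgroup (Equiv.Perm (GaloisCosets K L E)))
    (hN : (leftTranslation K L E).range ≤ Subgroup.normalizer (N : Set _)) : Prop :=
  ∃ φ : S.H ≃ₐ[K] fixedSubalgebra N hN,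
    let ι : S.H →ₐ[K] MonoidAlgebra E N := (fixedSubalgebra N hN).val.comp φ.toAlgHom
    (∀ h : S.H, Coalgebra.counit (R := E) (ι h) = algebraMap K E (Coalgebra.counit h)) ∧
    (∀ h : S.H, Coalgebra.comul (R := E) (ι h) =
      TensorProduct.mapOfCompatibleSMul E K K (MonoidAlgebra E N) (MonoidAlgebra E N)
        (TensorProduct.map ι.toLinearMap ι.toLinearMap (Coalgebra.comul h))) ∧
    ∀ (h : S.H) (x : L), algebraMap L E (S.μ h x) =
      (ι h).coeff.sum fun n c =>
        c * cosetEval ((n⁻¹ : N).1 (QuotientGroup.mk (1 : E ≃ₐ[K] E))) x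

end Correspondence

/-- The Hopf Galois structure `S` has type `T`: the regular subgroup of `Sym(G / G')` normalized by
`λ(G)` to which it corresponds is isomorphic to the group `T`. -/
def HasType {K L : Type*} [Field K] [Field L] [Algebra K L] (S : HopfGaloisStructure K L)
    (E : Type*) [Field E] [Algebra K E] [Algebra L E] [IsScalarTower K L E]
    (T : Type*) [Group T] : Prop :=
  ∃ (N : Subgroup (Equiv.Perm (GaloisCosets K L E)))
    (hN : (leftTranslation K L E).range ≤ Subgroup.normalizer (N : Set _)),
    IsRegularSubgroup N ∧ S.CorrespondsTo N hN ∧ Nonempty (N ≃* T)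

end HopfGaloisStructure

/-- `L / K`, with Galois closure `E`, has a Hopf Galois structure of type `T`. Finite `K`-vector
spaces have copies in the universe of `E`, so taking `H` in that universe is no restriction. -/
def HasHopfGaloisStructureOfType.{u, v, w, z} (K : Type u) (L : Type v) (E : Type w) [Field K]
    [Field L] [Field E] [Algebra K L] [Algebra K E] [Algebra L E] [IsScalarTower K L E]
    (T : Type z) [Group T] : Prop :=
  ∃ S : HopfGaloisStructure.{w} K L, S.HasType E T

/-! ### The groups of order `2 p ^ 2` -/

/-- The cyclic group of order `n`, written multiplicatively. -/
abbrev Cyc (n : ℕ) : Type := Multiplicative (ZMod n)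

/-- The action of `C₂` on a commutative group whose generator acts by inversion. -/
def inversionAction (A : Type*) [CommGroup A] : Cyc 2 →* MulAut A where
  toFun c := if c = 1 then 1 else MulEquiv.inv A
  map_one' := if_pos rfl
  map_mul' := by
    have h : (MulEquiv.inv A : MulAut A) * MulEquiv.inv A = 1 := by
      ext a
      exact inv_inv a
    have h2 : ∀ c : Cyc 2, c = 1 ∨ c = Multiplicative.ofAdd 1 := by decide
    have h3 : (Multiplicative.ofAdd 1 : Cyc 2) ≠ 1 := by decide
    have h4 : (Multiplicative.ofAdd 1 * Multiplicative.ofAdd 1 : Cyc 2) = 1 := by decide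
    intro c d
    rcases h2 c with rfl | rfl <;> rcases h2 d with rfl | rfl <;> simp [h3, h4, h]

/-- `(C_p × C_p) ⋊ C₂`, where the generator of `C₂` acts by inversion. -/
abbrev InversionSemidirect (p : ℕ) : Type :=
  (Cyc p × Cyc p) ⋊[inversionAction (Cyc p × Cyc p)] Cyc 2

end

/-! By the Greither–Pareigis correspondence the statement is about permutation groups. Given a
regular subgroup `N` normalized by `λ(G)`, it suffices to find a regular `N'` of the required type
whose normalizer contains the whole normalizer of `N`: then `λ(G)` normalizes `N'` too, and `N'`
yields a Hopf Galois structure.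

Choosing a base point identifies the set permuted with a group `Q ≅ N` acting by left translation,
and the normalizer of `N` with the holomorph of `Q`, the maps `q ↦ m · α(q)`. The group `N'` is
sought inside the holomorph, as the maps `q ↦ f(t) · τ_t(q)`, that is, by twisting the product of
`Q` (`exists_regular_of_twist`). It is normalized by the holomorph when `τ` commutes with `Aut(Q)`
and is constant on the resulting conjugates.

Both types have the form `Q = Z × D` with `Z` abelian and `D` carrying a sign in `C₂`: `Z = C_p ×
C_p`, `D = C₂`, or `Z = C_p`, `D = D_{2p}`. Elements of sign `-1` are made to invert `Z`
(`exists_regular_of_sign`), which turns either product into `(C_p × C_p) ⋊ C₂`. Since `p` is odd,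
`Z`, `D` and the sign are preserved by all automorphisms, as the twist requires.

The way back from `N'` is Galois descent (`IsForm.of_range_eq`): `E[N']^G` is a `K`-form of the Hopf
algebra `E[N']`, `L` is a `K`-form of the algebra of functions `G / G' → E`, and the action of
`E[N']` on these functions descends. -/

noncomputable section

/-! ### Forms of a vector space over a subfield -/

section Forms

set_option linter.unusedSectionVars false

variable {K : Type*} (E : Type*) [Field K] [Field E] [Algebra K E]
  {M M' M'' V V' V'' : Type*} [AddCommGroup M] [Module K M] [AddCommGroup M'] [Module K M']
  [AddCommGroup M''] [Module K M'']
  [AddCommGroup V] [Module K V] [Module E V] [IsScalarTower K E V]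
  [AddCommGroup V'] [Module K V'] [Module E V'] [IsScalarTower K E V']
  [AddCommGroup V''] [Module K V''] [Module E V''] [IsScalarTower K E V'']

/-- The map `i : M → V` makes the finite `K`-vector space `M` a `K`-form of the `E`-vector space
`V`: it maps some `K`-basis of `M` to an `E`-basis of `V`. -/
def IsForm (i : M →ₗ[K] V) : Prop :=
  ∃ (n : ℕ) (b : Module.Basis (Fin n) K M) (B : Module.Basis (Fin n) E V), ∀ k, i (b k) = B k

/-- The map `x ⊗ y ↦ i x ⊗ i' y` from a tensor product over `K` to a tensor product over `E`. -/
def formTensor (i : M →ₗ[K] V) (i' : M' →ₗ[K] V') : M ⊗[K] M' →ₗ[K] V ⊗[E] V' :=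
  TensorProduct.mapOfCompatibleSMul E K K V V' ∘ₗ TensorProduct.map i i'

@[simp]
theorem formTensor_tmul (i : M →ₗ[K] V) (i' : M' →ₗ[K] V') (x : M) (y : M') :
    formTensor E i i' (x ⊗ₜ y) = i x ⊗ₜ i' y := rfl

variable {E}

theorem IsForm.tensor {i : M →ₗ[K] V} {i' : M' →ₗ[K] V'} (hi : IsForm E i) (hi' : IsForm E i') :
    IsForm E (formTensor E i i') := by
  obtain ⟨n, b, B, h⟩ := hi
  obtain ⟨n', b', B', h'⟩ := hi'
  exact ⟨n * n', (b.tensorProduct b').reindex finProdFinEquiv,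
    (B.tensorProduct B').reindex finProdFinEquiv, fun k => by simp [h, h']⟩

theorem IsForm.injective {i : M →ₗ[K] V} (hi : IsForm E i) : Function.Injective i := by
  obtain ⟨n, b, B, h⟩ := hi
  refine (injective_iff_map_eq_zero i).2 fun x hx => b.ext_elem fun k => ?_
  rw [← b.sum_repr x, map_sum] at hx
  simp_rw [map_smul, h] at hx
  simpa using Fintype.linearIndependent_iff.1 (B.linearIndependent.restrict_scalars' K) _ hx k

theorem IsForm.finite {i : M →ₗ[K] V} (hi : IsForm E i) : Module.Finite K M := by
  obtain ⟨n, b, -, -⟩ := hi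
  exact Module.Finite.of_basis b

theorem IsForm.finrank_eq {i : M →ₗ[K] V} (hi : IsForm E i) :
    Module.finrank K M = Module.finrank E V := by
  obtain ⟨n, b, B, -⟩ := hi
  rw [Module.finrank_eq_card_basis b, Module.finrank_eq_card_basis B]

/-- Two `E`-linear maps which agree on a form agree. -/
theorem IsForm.ext {i : M →ₗ[K] V} (hi : IsForm E i) {f g : V →ₗ[E] V'}
    (h : ∀ m, f (i m) = g (i m)) : f = g := by
  obtain ⟨n, b, B, hb⟩ := hi
  exact B.ext fun k => by rw [← hb, h]

/-- A `K`-form consists of invariant vectors for a semilinear action of the Galois group only if it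
contains all of them. -/
theorem IsForm.mem_range [IsGalois K E] [FiniteDimensional K E] {i : M →ₗ[K] V} (hi : IsForm E i)
    (ρ : ∀ g : E ≃ₐ[K] E, V →ₛₗ[(g : E →+* E)] V) (hρ : ∀ g m, ρ g (i m) = i m) {w : V}
    (hw : ∀ g, ρ g w = w) : w ∈ LinearMap.range i := by
  obtain ⟨n, b, B, h⟩ := hi
  -- In a basis of invariant vectors, the coordinates of an invariant vector are Galois invariant,
  -- hence lie in `K`.
  have key : ∀ k, ∃ c : K, algebraMap K E c = B.repr w k := by
    intro k
    refine (IsGalois.mem_range_algebraMap_iff_fixed (B.repr w k)).2 fun g => ?_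
    have h1 : w = ∑ k, g (B.repr w k) • B k := by
      conv_lhs => rw [← hw g, ← B.sum_repr w, map_sum]
      refine Finset.sum_congr rfl fun j _ => ?_
      rw [map_smulₛₗ, ← h, hρ]
      rfl
    conv_rhs => rw [h1, B.repr_sum_self]
  choose c hc using key
  refine ⟨∑ k, c k • b k, ?_⟩
  conv_rhs => rw [← B.sum_repr w]
  rw [map_sum]
  refine Finset.sum_congr rfl fun j _ => ?_
  rw [map_smul, h, ← hc, algebraMap_smul]

/-- Galois descent: the invariants of a semilinear action of the Galois group are a form. -/
theorem IsForm.of_range_eq [IsGalois K E] [FiniteDimensional K E] [Module.Finite E V]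
    {i : M →ₗ[K] V} (hinj : Function.Injective i)
    (ρ : ∀ g : E ≃ₐ[K] E, V →ₛₗ[(g : E →+* E)] V) (hρ1 : ∀ v, ρ 1 v = v)
    (hρmul : ∀ g h v, ρ (g * h) v = ρ g (ρ h v))
    (hi : ∀ v, v ∈ LinearMap.range i ↔ ∀ g, ρ g v = v) : IsForm E i := by
  classical
  have : Module.Finite K V := Module.Finite.trans E V
  have : Module.Finite K M := Module.Finite.of_injective i hinj
  let b := Module.finBasis K M
  have hfix : ∀ m g, ρ g (i m) = i m := fun m g => (hi _).1 ⟨m, rfl⟩ g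
  have htr : ∀ v, ∃ m, i m = ∑ g, ρ g v := fun v => (hi _).2 fun g => by
    rw [map_sum]
    simp_rw [← hρmul]
    exact Fintype.sum_equiv (Equiv.mulLeft g) _ _ fun _ => rfl
  have hli : LinearIndependent E (i ∘ b) := by
    rw [Fintype.linearIndependent_iff]
    intro c hc k
    -- Multiplying the relation by `e` and summing over `G` replaces each coefficient by a trace,
    -- giving a relation over `K`. Nondegeneracy of the trace form then kills `c k`.
    have h1 : ∀ e, Algebra.trace K E (c k * e) = 0 := by
      intro e
      have h2 : i (∑ k, Algebra.trace K E (c k * e) • b k) = 0 := by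
        calc i (∑ k, Algebra.trace K E (c k * e) • b k)
            = ∑ k, ∑ g : E ≃ₐ[K] E, ρ g ((c k * e) • i (b k)) := by
              rw [map_sum]
              refine Finset.sum_congr rfl fun k _ => ?_
              rw [map_smul, ← algebraMap_smul E, trace_eq_sum_automorphisms, Finset.sum_smul]
              refine Finset.sum_congr rfl fun g _ => ?_
              rw [map_smulₛₗ, hfix]
              rfl
          _ = ∑ g : E ≃ₐ[K] E, ρ g (e • ∑ k, c k • (i ∘ b) k) := by
              rw [Finset.sum_comm]
              refine Finset.sum_congr rfl fun g _ => ?_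
              rw [Finset.smul_sum, map_sum]
              refine Finset.sum_congr rfl fun k _ => ?_
              rw [smul_smul, mul_comm]
              rfl
          _ = 0 := Finset.sum_eq_zero fun g _ => by rw [hc, smul_zero, map_zero]
      exact Fintype.linearIndependent_iff.1 b.linearIndependent _
        (hinj (h2.trans (map_zero i).symm)) k
    exact (traceForm_nondegenerate K E).1 (c k) h1
  have hspan : ⊤ ≤ Submodule.span E (Set.range (i ∘ b)) := by
    by_contra hne
    obtain ⟨v, -, hv⟩ := SetLike.not_le_iff_exists.1 hne
    -- A functional vanishing on the invariants kills `∑ g, ρ g (e • v) = ∑ g, g(e) • ρ g v` for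
    -- every `e`. Independence of the characters `g` forces `φ (ρ g v) = 0`, and `g = 1` contradicts
    -- `φ v ≠ 0`.
    obtain ⟨φ, hφv, hφ⟩ := Submodule.exists_dual_map_eq_bot_of_notMem hv inferInstance
    have hφi : ∀ m, φ (i m) = 0 := by
      intro m
      rw [← b.sum_repr m, map_sum, map_sum]
      refine Finset.sum_eq_zero fun k _ => ?_
      have : φ (i (b k)) ∈ (Submodule.span E (Set.range (i ∘ b))).map φ :=
        ⟨_, Submodule.subset_span ⟨k, rfl⟩, rfl⟩
      rw [hφ, Submodule.mem_bot] at this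
      rw [map_smul, ← algebraMap_smul E, map_smul, this, smul_zero]
    have hind := (linearIndependent_monoidHom E E).comp
      (fun g : E ≃ₐ[K] E => (g : E →* E)) fun g h hgh => by
        ext x
        exact DFunLike.congr_fun hgh x
    have := Fintype.linearIndependent_iff.1 hind (fun g => φ (ρ g v)) (by
      ext e
      obtain ⟨m, hm⟩ := htr (e • v)
      have h3 := hφi m
      rw [hm, map_sum] at h3
      simp only [Function.comp_apply, Finset.sum_apply, Pi.smul_apply, Pi.zero_apply, smul_eq_mul]
      rw [← h3]
      refine Finset.sum_congr rfl fun g _ => ?_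
      rw [map_smulₛₗ, map_smul, smul_eq_mul, mul_comm]
      rfl) 1
    rw [hρ1] at this
    exact hφv this
  exact ⟨_, b, Module.Basis.mk hli hspan, fun k => by simp⟩

theorem formTensor_lTensor (i : M →ₗ[K] V) (i' : M' →ₗ[K] V') (i'' : M'' →ₗ[K] V'')
    (f : M' →ₗ[K] M'') (F : V' →ₗ[E] V'') (h : ∀ m, F (i' m) = i'' (f m)) (t : M ⊗[K] M') :
    formTensor E i i'' (f.lTensor M t) = F.lTensor V (formTensor E i i' t) := by
  induction t with
  | zero => simp
  | add x y hx hy => simp only [map_add, hx, hy]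
  | tmul x y => simp [h]

theorem formTensor_rTensor (i : M →ₗ[K] V) (i' : M' →ₗ[K] V') (i'' : M'' →ₗ[K] V'')
    (f : M' →ₗ[K] M'') (F : V' →ₗ[E] V'') (h : ∀ m, F (i' m) = i'' (f m)) (t : M' ⊗[K] M) :
    formTensor E i'' i (f.rTensor M t) = F.rTensor V (formTensor E i' i t) := by
  induction t with
  | zero => simp
  | add x y hx hy => simp only [map_add, hx, hy]
  | tmul x y => simp [h]

theorem formTensor_assoc (i : M →ₗ[K] V) (i' : M' →ₗ[K] V') (i'' : M'' →ₗ[K] V'')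
    (t : (M ⊗[K] M') ⊗[K] M'') :
    formTensor E i (formTensor E i' i'') (TensorProduct.assoc K M M' M'' t) =
      TensorProduct.assoc E V V' V'' (formTensor E (formTensor E i i') i'' t) := by
  induction t with
  | zero => simp
  | add x y hx hy => simp only [map_add, hx, hy]
  | tmul x y =>
    induction x with
    | zero => simp
    | add x y hx hy => simp only [TensorProduct.add_tmul, map_add, hx, hy]
    | tmul x z => simp

theorem formTensor_comm (i : M →ₗ[K] V) (i' : M' →ₗ[K] V') (t : M ⊗[K] M') :
    formTensor E i' i (TensorProduct.comm K M M' t) =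
      TensorProduct.comm E V V' (formTensor E i i' t) := by
  induction t with
  | zero => simp
  | add x y hx hy => simp only [map_add, hx, hy]
  | tmul x y => simp

end Forms

/-! ### Forms of Hopf algebras -/

section HopfForms

variable {K E : Type*} [Field K] [Field E] [Algebra K E] {H A : Type*} [Ring H] [Algebra K H]
  [Ring A] [HopfAlgebra E A] [Algebra K A] [IsScalarTower K E A] (ι : H →ₐ[K] A)

/-- The algebra `H` over `K` is a form of the Hopf algebra `A` over `E`, and the structure maps of
`A` restrict to it. -/
structure IsHopfForm (E : Type*) [Field E] [Algebra K E] {H A : Type*} [Ring H] [Algebra K H]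
    [Ring A] [HopfAlgebra E A] [Algebra K A] [IsScalarTower K E A] (ι : H →ₐ[K] A) : Prop where
  isForm : IsForm E ι.toLinearMap
  counit : ∀ h, Coalgebra.counit (R := E) (ι h) ∈ LinearMap.range (Algebra.linearMap K E)
  comul : ∀ h, Coalgebra.comul (R := E) (ι h) ∈
    LinearMap.range (formTensor E ι.toLinearMap ι.toLinearMap)
  antipode : ∀ h, HopfAlgebra.antipode E (ι h) ∈ LinearMap.range ι.toLinearMap

theorem formTensor_mul (x y : H ⊗[K] H) : formTensor E ι.toLinearMap ι.toLinearMap (x * y) =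
    formTensor E ι.toLinearMap ι.toLinearMap x * formTensor E ι.toLinearMap ι.toLinearMap y := by
  induction x with
  | zero => simp
  | add x x' hx hx' => simp only [add_mul, map_add, hx, hx']
  | tmul a b =>
    induction y with
    | zero => simp
    | add y y' hy hy' => simp only [mul_add, map_add, hy, hy']
    | tmul c d => simp

namespace IsHopfForm

variable {ι}

theorem injective (hι : IsHopfForm E ι) : Function.Injective ι := hι.isForm.injective

/-- Identities in `H ⊗ H` over `K` may thus be checked in `A ⊗ A` over `E`; the Hopf algebra axioms
for `H` are inherited from `A` in this way. -/
theorem tensor_injective (hι : IsHopfForm E ι) :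
    Function.Injective (formTensor E ι.toLinearMap ι.toLinearMap) :=
  (hι.isForm.tensor hι.isForm).injective

variable (hι : IsHopfForm E ι)

/-- The counit of a Hopf algebra form. -/
def descCounit : H →ₗ[K] K :=
  ((Coalgebra.counit (R := E) (A := A)).restrictScalars K ∘ₗ ι.toLinearMap).codRestrictOfInjective
    (Algebra.linearMap K E) (algebraMap K E).injective hι.counit

/-- The comultiplication of a Hopf algebra form. -/
def descComul : H →ₗ[K] H ⊗[K] H :=
  ((Coalgebra.comul (R := E) (A := A)).restrictScalars K ∘ₗ ι.toLinearMap).codRestrictOfInjective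
    (formTensor E ι.toLinearMap ι.toLinearMap) hι.tensor_injective hι.comul

/-- The antipode of a Hopf algebra form. -/
def descAntipode : H →ₗ[K] H :=
  ((HopfAlgebra.antipode E (A := A)).restrictScalars K ∘ₗ ι.toLinearMap).codRestrictOfInjective
    ι.toLinearMap hι.injective hι.antipode

theorem algebraMap_descCounit (h : H) :
    algebraMap K E (hι.descCounit h) = Coalgebra.counit (R := E) (ι h) :=
  LinearMap.codRestrictOfInjective_comp_apply
    ((Coalgebra.counit (R := E) (A := A)).restrictScalars K ∘ₗ ι.toLinearMap)
    (Algebra.linearMap K E) (algebraMap K E).injective hι.counit h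

theorem formTensor_descComul (h : H) :
    formTensor E ι.toLinearMap ι.toLinearMap (hι.descComul h) =
      Coalgebra.comul (R := E) (ι h) :=
  LinearMap.codRestrictOfInjective_comp_apply _ _ _ _ h

theorem map_descAntipode (h : H) : ι (hι.descAntipode h) = HopfAlgebra.antipode E (ι h) :=
  LinearMap.codRestrictOfInjective_comp_apply
    ((HopfAlgebra.antipode E (A := A)).restrictScalars K ∘ₗ ι.toLinearMap)
    ι.toLinearMap hι.injective hι.antipode h

/-- The coalgebra structure on a Hopf algebra form. -/
@[reducible]
def coalgebra : Coalgebra K H where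
  counit := hι.descCounit
  comul := hι.descComul
  coassoc := by
    ext h
    apply (hι.isForm.tensor (hι.isForm.tensor hι.isForm)).injective
    simp only [LinearMap.comp_apply, LinearEquiv.coe_coe]
    rw [formTensor_assoc,
      formTensor_rTensor ι.toLinearMap ι.toLinearMap (formTensor E ι.toLinearMap ι.toLinearMap)
        hι.descComul Coalgebra.comul (fun m => (hι.formTensor_descComul m).symm),
      formTensor_lTensor ι.toLinearMap ι.toLinearMap (formTensor E ι.toLinearMap ι.toLinearMap)
        hι.descComul Coalgebra.comul (fun m => (hι.formTensor_descComul m).symm),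
      formTensor_descComul, Coalgebra.coassoc_apply]
  rTensor_counit_comp_comul := by
    ext h
    apply (TensorProduct.lid K H).injective
    apply hι.injective
    have key : ∀ t : H ⊗[K] H, ι (TensorProduct.lid K H (hι.descCounit.rTensor H t)) =
        TensorProduct.lid E A ((Coalgebra.counit (R := E) (A := A)).rTensor A
          (formTensor E ι.toLinearMap ι.toLinearMap t)) := by
      intro t
      induction t with
      | zero => simp
      | add x y hx hy => simp only [map_add, hx, hy]
      | tmul x y => simp [← algebraMap_descCounit hι]
    simp only [LinearMap.comp_apply]
    rw [key, formTensor_descComul, Coalgebra.rTensor_counit_comul]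
    simp
  lTensor_counit_comp_comul := by
    ext h
    apply (TensorProduct.rid K H).injective
    apply hι.injective
    have key : ∀ t : H ⊗[K] H, ι (TensorProduct.rid K H (hι.descCounit.lTensor H t)) =
        TensorProduct.rid E A ((Coalgebra.counit (R := E) (A := A)).lTensor A
          (formTensor E ι.toLinearMap ι.toLinearMap t)) := by
      intro t
      induction t with
      | zero => simp
      | add x y hx hy => simp only [map_add, hx, hy]
      | tmul x y => simp [← algebraMap_descCounit hι]
    simp only [LinearMap.comp_apply]
    rw [key, formTensor_descComul, Coalgebra.lTensor_counit_comul]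
    simp

/-- The Hopf algebra structure on a Hopf algebra form. -/
@[reducible]
def hopfAlgebra : HopfAlgebra K H :=
  letI := hι.coalgebra
  { Bialgebra.mk' K H
      (by
        apply (algebraMap K E).injective
        exact (hι.algebraMap_descCounit 1).trans (by simp))
      (by
        intro a b
        apply (algebraMap K E).injective
        refine (hι.algebraMap_descCounit _).trans ?_
        rw [map_mul, Bialgebra.counit_mul, map_mul]
        exact congrArg₂ _ (hι.algebraMap_descCounit a).symm (hι.algebraMap_descCounit b).symm)
      (by
        apply hι.tensor_injective
        refine (hι.formTensor_descComul 1).trans ?_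
        rw [map_one, Bialgebra.comul_one, Algebra.TensorProduct.one_def,
          Algebra.TensorProduct.one_def, formTensor_tmul]
        simp)
      (by
        intro a b
        apply hι.tensor_injective
        refine (hι.formTensor_descComul _).trans ?_
        rw [map_mul, Bialgebra.comul_mul, formTensor_mul]
        exact congrArg₂ _ (hι.formTensor_descComul a).symm (hι.formTensor_descComul b).symm) with
    antipode := hι.descAntipode
    mul_antipode_rTensor_comul := by
      ext h
      apply hι.injective
      have key : ∀ t : H ⊗[K] H, ι (LinearMap.mul' K H (hι.descAntipode.rTensor H t)) =
          LinearMap.mul' E A ((HopfAlgebra.antipode E (A := A)).rTensor A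
            (formTensor E ι.toLinearMap ι.toLinearMap t)) := by
        intro t
        induction t with
        | zero => simp
        | add x y hx hy => simp only [map_add, hx, hy]
        | tmul x y => simp [map_descAntipode hι]
      refine (key _).trans ?_
      refine (congrArg (fun t => LinearMap.mul' E A ((HopfAlgebra.antipode E (A := A)).rTensor A t))
        (hι.formTensor_descComul h)).trans ?_
      rw [HopfAlgebra.mul_antipode_rTensor_comul_apply, ← hι.algebraMap_descCounit,
        ← IsScalarTower.algebraMap_apply]
      exact (ι.commutes _).symm
    mul_antipode_lTensor_comul := by
      ext h
      apply hι.injective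
      have key : ∀ t : H ⊗[K] H, ι (LinearMap.mul' K H (hι.descAntipode.lTensor H t)) =
          LinearMap.mul' E A ((HopfAlgebra.antipode E (A := A)).lTensor A
            (formTensor E ι.toLinearMap ι.toLinearMap t)) := by
        intro t
        induction t with
        | zero => simp
        | add x y hx hy => simp only [map_add, hx, hy]
        | tmul x y => simp [map_descAntipode hι]
      refine (key _).trans ?_
      refine (congrArg (fun t => LinearMap.mul' E A ((HopfAlgebra.antipode E (A := A)).lTensor A t))
        (hι.formTensor_descComul h)).trans ?_
      rw [HopfAlgebra.mul_antipode_lTensor_comul_apply, ← hι.algebraMap_descCounit,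
        ← IsScalarTower.algebraMap_apply]
      exact (ι.commutes _).symm }

theorem isCocomm [Coalgebra.IsCocomm E A] :
    letI := hι.coalgebra
    Coalgebra.IsCocomm K H := by
  let _ := hι.coalgebra
  refine ⟨?_⟩
  ext h
  apply hι.tensor_injective
  refine (formTensor_comm _ _ _).trans ?_
  refine (congrArg _ (hι.formTensor_descComul h)).trans ?_
  rw [Coalgebra.comm_comul]
  exact (hι.formTensor_descComul h).symm

end IsHopfForm

end HopfForms

/-! ### The Hopf Galois structure attached to a regular subgroup -/

section GaloisClosure

variable (K L E : Type*) [Field K] [Field L] [Field E] [Algebra K L] [Algebra K E]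

theorem IsNormalClosure.finiteDimensional [FiniteDimensional K L] [IsNormalClosure K L E] :
    FiniteDimensional K E := by
  have h : IntermediateField.normalClosure K L E = ⊤ :=
    (Algebra.IsAlgebraic.isNormalClosure_iff.1 ‹_›).2
  have := normalClosure.is_finiteDimensional K L E
  rw [h] at this
  exact Module.Finite.equiv IntermediateField.topEquiv.toLinearEquiv

theorem IsNormalClosure.isGalois [FiniteDimensional K L] [IsNormalClosure K L E]
    [Algebra.IsSeparable K L] : IsGalois K E := by
  have h : IntermediateField.normalClosure K L E = ⊤ :=
    (Algebra.IsAlgebraic.isNormalClosure_iff.1 ‹_›).2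
  have hsep : Algebra.IsSeparable K E := by
    rw [← separableClosure.eq_top_iff, eq_top_iff, ← h,
      normalClosure_le_iff]
    rintro f _ ⟨x, rfl⟩
    rw [mem_separableClosure_iff]
    exact IsSeparable.map f f.injective (Algebra.IsSeparable.isSeparable K x)
  have := IsNormalClosure.normal (F := K) (K := L) (L := E)
  exact ⟨⟩

end GaloisClosure

namespace HopfGaloisStructure

section Construction

variable {K L E : Type*} [Field K] [Field L] [Field E] [Algebra K L] [Algebra K E] [Algebra L E]
  [IsScalarTower K L E]

/-! ### Descent of the Hopf algebra `E[N]` to `E[N]^G`. -/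

section GroupAlgebra

variable (N : Subgroup (Equiv.Perm (GaloisCosets K L E)))
  (hN : (leftTranslation K L E).range ≤ Subgroup.normalizer (N : Set _))

/-- The action of `g ∈ G` on `E[N]` as a semilinear map. -/
def galoisActSemilinear (g : E ≃ₐ[K] E) :
    MonoidAlgebra E N →ₛₗ[(g : E →+* E)] MonoidAlgebra E N where
  toFun := galoisAct N hN g
  map_add' := map_add _
  map_smul' c a := by
    induction a using MonoidAlgebra.induction_linear with
    | zero => simp
    | add x y hx hy => simp only [smul_add, map_add, hx, hy]
    | single n d => simp [galoisAct_single]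

theorem galoisActSemilinear_apply (g : E ≃ₐ[K] E) (a : MonoidAlgebra E N) :
    galoisActSemilinear N hN g a = galoisAct N hN g a := rfl

theorem conj_one (n : N) : conj N hN 1 n = n := by
  ext : 1
  change leftTranslation K L E 1 * n.1 * (leftTranslation K L E 1)⁻¹ = n.1
  rw [map_one, one_mul, inv_one, mul_one]

theorem conj_mul (g h : E ≃ₐ[K] E) (n : N) : conj N hN (g * h) n = conj N hN g (conj N hN h n) := by
  ext : 1
  change leftTranslation K L E (g * h) * n.1 * (leftTranslation K L E (g * h))⁻¹ =
    leftTranslation K L E g * (leftTranslation K L E h * n.1 * (leftTranslation K L E h)⁻¹) *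
      (leftTranslation K L E g)⁻¹
  rw [map_mul]
  group

theorem galoisAct_one (a : MonoidAlgebra E N) : galoisAct N hN 1 a = a := by
  induction a using MonoidAlgebra.induction_linear with
  | zero => simp
  | add x y hx hy => simp only [map_add, hx, hy]
  | single n d => simp [galoisAct_single, conj_one]

theorem galoisAct_mul (g h : E ≃ₐ[K] E) (a : MonoidAlgebra E N) :
    galoisAct N hN (g * h) a = galoisAct N hN g (galoisAct N hN h a) := by
  induction a using MonoidAlgebra.induction_linear with
  | zero => simp
  | add x y hx hy => simp only [map_add, hx, hy]
  | single n d => simp [galoisAct_single, conj_mul]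

theorem counit_galoisAct (g : E ≃ₐ[K] E) (a : MonoidAlgebra E N) :
    Coalgebra.counit (R := E) (galoisAct N hN g a) = g (Coalgebra.counit (R := E) a) := by
  induction a using MonoidAlgebra.induction_linear with
  | zero => simp
  | add x y hx hy => simp only [map_add, hx, hy]
  | single n d => simp [galoisAct_single]

theorem antipode_galoisAct (g : E ≃ₐ[K] E) (a : MonoidAlgebra E N) :
    HopfAlgebra.antipode E (galoisAct N hN g a) =
      galoisAct N hN g (HopfAlgebra.antipode E a) := by
  induction a using MonoidAlgebra.induction_linear with
  | zero => simp
  | add x y hx hy => simp only [map_add, hx, hy]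
  | single n d => simp [galoisAct_single]

theorem comul_galoisAct (g : E ≃ₐ[K] E) (a : MonoidAlgebra E N) :
    Coalgebra.comul (R := E) (galoisAct N hN g a) =
      TensorProduct.map (galoisActSemilinear N hN g) (galoisActSemilinear N hN g)
        (Coalgebra.comul (R := E) a) := by
  induction a using MonoidAlgebra.induction_linear with
  | zero => simp
  | add x y hx hy => simp only [map_add, hx, hy]
  | single n d => simp [galoisAct_single, galoisActSemilinear_apply]

variable [FiniteDimensional K E] [IsGalois K E]

theorem isForm_fixedSubalgebra : IsForm E (fixedSubalgebra N hN).val.toLinearMap := by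
  have : Module.Finite E (MonoidAlgebra E N) := Module.Finite.of_basis (MonoidAlgebra.basis N E)
  refine IsForm.of_range_eq Subtype.val_injective (galoisActSemilinear N hN) (galoisAct_one N hN)
    (galoisAct_mul N hN) fun v => ?_
  simp only [galoisActSemilinear_apply]
  rw [← mem_fixedSubalgebra]
  exact ⟨fun ⟨x, hx⟩ => hx ▸ x.2, fun h => ⟨⟨v, h⟩, rfl⟩⟩

theorem isHopfForm_fixedSubalgebra : IsHopfForm E (fixedSubalgebra N hN).val where
  isForm := isForm_fixedSubalgebra N hN
  counit h := by
    refine (IsGalois.mem_range_algebraMap_iff_fixed _).2 fun g => ?_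
    rw [← counit_galoisAct N hN]
    exact congrArg _ ((mem_fixedSubalgebra N hN h.1).1 h.2 g)
  antipode h := by
    refine ⟨⟨HopfAlgebra.antipode E h.1, (mem_fixedSubalgebra N hN _).2 fun g => ?_⟩, rfl⟩
    rw [← antipode_galoisAct, (mem_fixedSubalgebra N hN h.1).1 h.2 g]
  comul h := by
    -- The tensor square of the form is a form of `E[N] ⊗ E[N]` made of invariant tensors, so it
    -- contains every invariant tensor, in particular the coproduct of an invariant element.
    refine ((isForm_fixedSubalgebra N hN).tensor (isForm_fixedSubalgebra N hN)).mem_range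
      (fun g => TensorProduct.map (galoisActSemilinear N hN g) (galoisActSemilinear N hN g))
      (fun g m => ?_) fun g => ?_
    · induction m with
      | zero => simp
      | add x y hx hy => simp only [map_add, hx, hy]
      | tmul x y =>
        simp only [formTensor_tmul, TensorProduct.map_tmul, galoisActSemilinear_apply]
        congr 1
        · exact (mem_fixedSubalgebra N hN x.1).1 x.2 g
        · exact (mem_fixedSubalgebra N hN y.1).1 y.2 g
    · rw [← comul_galoisAct]
      exact congrArg _ ((mem_fixedSubalgebra N hN h.1).1 h.2 g)

end GroupAlgebra

/-! ### Functions on `G / G'`: the form `L` and the action of `E[N]`. -/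

section Functions

/-- The embedding of `L` into the functions from `G / G'` to `E`. -/
def cosetHom : L →ₐ[K] (GaloisCosets K L E → E) :=
  AlgHom.pi fun y =>
    { toFun := cosetEval y
      map_one' := by induction y using QuotientGroup.induction_on; simp [cosetEval_mk]
      map_mul' := by induction y using QuotientGroup.induction_on; simp [cosetEval_mk]
      map_zero' := by induction y using QuotientGroup.induction_on; simp [cosetEval_mk]
      map_add' := by induction y using QuotientGroup.induction_on; simp [cosetEval_mk]
      commutes' := by
        induction y using QuotientGroup.induction_on
        simp [cosetEval_mk, ← IsScalarTower.algebraMap_apply] }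

theorem cosetHom_apply (x : L) (y : GaloisCosets K L E) : cosetHom x y = cosetEval y x := rfl

theorem cosetHom_injective : Function.Injective (cosetHom : L →ₐ[K] (GaloisCosets K L E → E)) := by
  intro x y h
  have := congrFun h (QuotientGroup.mk (1 : E ≃ₐ[K] E))
  simpa [cosetHom_apply, cosetEval_mk] using this

/-- The semilinear action of `g ∈ G` on the functions from `G / G'` to `E`. -/
def functionAct (g : E ≃ₐ[K] E) :
    (GaloisCosets K L E → E) →ₛₗ[(g : E →+* E)] (GaloisCosets K L E → E) where
  toFun f y := g (f (g⁻¹ • y))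
  map_add' f f' := by ext; simp
  map_smul' c f := by ext; simp

theorem functionAct_apply (g : E ≃ₐ[K] E) (f : GaloisCosets K L E → E) (y : GaloisCosets K L E) :
    functionAct g f y = g (f (g⁻¹ • y)) := rfl

/-- An invariant function is determined by its value at the coset of `1`. That value is fixed by
`G'`, so by the Galois correspondence it lies in the image of `L`. -/
theorem mem_range_cosetHom [FiniteDimensional K E] [IsGalois K E] (f : GaloisCosets K L E → E) :
    f ∈ LinearMap.range (cosetHom : L →ₐ[K] (GaloisCosets K L E → E)).toLinearMap ↔
      ∀ g : E ≃ₐ[K] E, functionAct g f = f := by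
  constructor
  · rintro ⟨x, rfl⟩ g
    ext y
    induction y using QuotientGroup.induction_on with
    | H h =>
      change g ((g⁻¹ * h) (algebraMap L E x)) = h (algebraMap L E x)
      rw [← AlgEquiv.mul_apply, mul_inv_cancel_left]
  · intro hf
    have h1 : f (QuotientGroup.mk 1) ∈
        IntermediateField.fixedField (galoisSubgroup K L E) := by
      rw [IntermediateField.mem_fixedField_iff]
      intro g hg
      have h2 := congrFun (hf g) (QuotientGroup.mk 1)
      rw [functionAct_apply] at h2
      have h3 : g⁻¹ • (QuotientGroup.mk 1 : GaloisCosets K L E) = QuotientGroup.mk 1 := by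
        rw [MulAction.Quotient.smul_mk, QuotientGroup.eq]
        simpa using hg
      rwa [h3] at h2
    rw [IsGalois.fixedField_fixingSubgroup] at h1
    obtain ⟨x, hx⟩ := h1
    refine ⟨x, ?_⟩
    ext y
    induction y using QuotientGroup.induction_on with
    | H h =>
      have h2 := congrFun (hf h) (QuotientGroup.mk h)
      rw [functionAct_apply, MulAction.Quotient.smul_mk, smul_eq_mul, inv_mul_cancel, ← hx] at h2
      exact h2

theorem isForm_cosetHom [FiniteDimensional K E] [IsGalois K E] :
    IsForm E (cosetHom : L →ₐ[K] (GaloisCosets K L E → E)).toLinearMap := by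
  refine IsForm.of_range_eq cosetHom_injective functionAct (fun v => ?_) (fun g h v => ?_)
    mem_range_cosetHom
  · ext y
    simp [functionAct_apply]
  · ext y
    simp [functionAct_apply, mul_smul]

variable (N : Subgroup (Equiv.Perm (GaloisCosets K L E)))

/-- The action of `N` on the functions from `G / G'` to `E`. -/
def permHom : N →* Module.End E (GaloisCosets K L E → E) where
  toFun n := LinearMap.funLeft E E ((n⁻¹ : N) : Equiv.Perm (GaloisCosets K L E))
  map_one' := by ext; simp [LinearMap.funLeft]
  map_mul' a b := by
    apply LinearMap.ext
    intro f
    ext y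
    simp [LinearMap.funLeft]

/-- The action of `E[N]` on the functions from `G / G'` to `E`. -/
def groupAlgebraHom : MonoidAlgebra E N →ₐ[E] Module.End E (GaloisCosets K L E → E) :=
  MonoidAlgebra.lift E _ N (permHom N)

theorem groupAlgebraHom_single (n : N) (c : E) (f : GaloisCosets K L E → E)
    (y : GaloisCosets K L E) :
    groupAlgebraHom N (MonoidAlgebra.single n c) f y = c * f ((n⁻¹ : N).1 y) := by
  simp [groupAlgebraHom, permHom, LinearMap.funLeft]

theorem groupAlgebraHom_apply (a : MonoidAlgebra E N) (f : GaloisCosets K L E → E)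
    (y : GaloisCosets K L E) :
    groupAlgebraHom N a f y = a.coeff.sum fun n c => c * f ((n⁻¹ : N).1 y) := by
  rw [groupAlgebraHom, MonoidAlgebra.lift_apply, Finsupp.sum, LinearMap.sum_apply,
    Finset.sum_apply]
  rfl

/-- This equivariance makes invariant elements of `E[N]` preserve the invariant functions, so that
`E[N]^G` acts on `L`. -/
theorem functionAct_groupAlgebraHom
    (hN : (leftTranslation K L E).range ≤ Subgroup.normalizer (N : Set _)) (g : E ≃ₐ[K] E)
    (a : MonoidAlgebra E N) (f : GaloisCosets K L E → E) :
    functionAct g (groupAlgebraHom N a f) =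
      groupAlgebraHom N (galoisAct N hN g a) (functionAct g f) := by
  induction a using MonoidAlgebra.induction_linear with
  | zero => simp
  | add x y hx hy => simp only [map_add, LinearMap.add_apply, hx, hy]
  | single n d =>
    ext y
    simp [galoisAct_single, groupAlgebraHom_single, functionAct_apply, conj]

theorem groupAlgebraHom_one (a : MonoidAlgebra E N) (y : GaloisCosets K L E) :
    groupAlgebraHom N a 1 y = Coalgebra.counit (R := E) a := by
  induction a using MonoidAlgebra.induction_linear with
  | zero => simp
  | add x y hx hy => simp only [map_add, LinearMap.add_apply, Pi.add_apply, hx, hy]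
  | single n d => simp [groupAlgebraHom_single]

theorem groupAlgebraHom_mul (a : MonoidAlgebra E N) (f f' : GaloisCosets K L E → E) :
    groupAlgebraHom N a (f * f') = LinearMap.mul' E (GaloisCosets K L E → E)
      (TensorProduct.map ((groupAlgebraHom N).toLinearMap.flip f)
        ((groupAlgebraHom N).toLinearMap.flip f') (Coalgebra.comul (R := E) a)) := by
  induction a using MonoidAlgebra.induction_linear with
  | zero => simp
  | add x y hx hy => simp only [map_add, LinearMap.add_apply, hx, hy]
  | single n d =>
    ext y
    simp [groupAlgebraHom_single, mul_left_comm]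

end Functions

end Construction

end HopfGaloisStructure

namespace HopfGaloisStructure

/-! ### From a regular subgroup to a Hopf Galois structure. -/

section OfRegular

variable {K L E : Type*} [Field K] [Field L] [Field E] [Algebra K L] [Algebra K E] [Algebra L E]
  [IsScalarTower K L E] [FiniteDimensional K E]
  (N : Subgroup (Equiv.Perm (GaloisCosets K L E)))

theorem lift_groupAlgebraHom_injective (hreg : IsRegularSubgroup N) :
    Function.Injective (TensorProduct.lift
      ((LinearMap.mul E (Module.End E (GaloisCosets K L E → E))).compl₁₂
        (Algebra.lmul E (GaloisCosets K L E → E)).toLinearMap (groupAlgebraHom N).toLinearMap)) := by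
  classical
  rw [injective_iff_map_eq_zero]
  intro t ht
  obtain ⟨f, rfl⟩ :=
    (TensorProduct.equivFinsuppOfBasisRight (M := GaloisCosets K L E → E)
      (MonoidAlgebra.basis N E)).symm.surjective t
  rw [TensorProduct.equivFinsuppOfBasisRight_symm_apply] at ht
  rw [map_eq_zero_iff _ (LinearEquiv.injective _)]
  ext n y
  -- For `t = ∑ fₙ ⊗ n`, the operator applied to the indicator function of `n⁻¹ y` takes the value
  -- `fₙ(y)` at `y`: by regularity no other `m` sends `y` to the same point under its inverse.
  have h := congrFun (LinearMap.congr_fun ht (Pi.single ((n⁻¹ : N).1 y) 1)) y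
  rw [Finsupp.sum_fintype _ _ (by simp), map_sum] at h
  simp only [MonoidAlgebra.basis_apply, TensorProduct.lift.tmul, LinearMap.sum_apply,
    Finset.sum_apply] at h
  rw [Finset.sum_eq_single n] at h
  · simpa [groupAlgebraHom_single] using h
  · intro m _ hm
    have : (m⁻¹ : N).1 y ≠ (n⁻¹ : N).1 y := fun h' =>
      hm (inv_injective ((hreg y _).unique h' rfl))
    simp only [LinearMap.compl₁₂_apply, AlgHom.toLinearMap_apply, LinearMap.mul_apply',
      Module.End.mul_apply, Algebra.coe_lmul_eq_mul, Pi.mul_apply, groupAlgebraHom_single]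
    rw [Pi.single_eq_of_ne this]
    simp
  · simp

variable [IsGalois K E]

theorem groupAlgebraHom_cosetHom_mem
    (hN : (leftTranslation K L E).range ≤ Subgroup.normalizer (N : Set _))
    (h : fixedSubalgebra N hN) (x : L) :
    groupAlgebraHom N h.1 (cosetHom x) ∈
      LinearMap.range (cosetHom : L →ₐ[K] (GaloisCosets K L E → E)).toLinearMap := by
  rw [mem_range_cosetHom]
  intro g
  have hx := (mem_range_cosetHom (cosetHom x : GaloisCosets K L E → E)).1 ⟨x, rfl⟩ g
  rw [functionAct_groupAlgebraHom N hN, (mem_fixedSubalgebra N hN h.1).1 h.2 g, hx]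

/-- The action of `h ∈ E[N]^G` on `L`. -/
def fixedActAux (hN : (leftTranslation K L E).range ≤ Subgroup.normalizer (N : Set _))
    (h : fixedSubalgebra N hN) : Module.End K L :=
  LinearMap.codRestrictOfInjective
    ((groupAlgebraHom N h.1).restrictScalars K ∘ₗ
      (cosetHom : L →ₐ[K] (GaloisCosets K L E → E)).toLinearMap)
    (cosetHom : L →ₐ[K] (GaloisCosets K L E → E)).toLinearMap cosetHom_injective
    (groupAlgebraHom_cosetHom_mem N hN h)

theorem cosetHom_fixedActAux
    (hN : (leftTranslation K L E).range ≤ Subgroup.normalizer (N : Set _))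
    (h : fixedSubalgebra N hN) (x : L) :
    (cosetHom (fixedActAux N hN h x) : GaloisCosets K L E → E) =
      groupAlgebraHom N h.1 (cosetHom x) :=
  LinearMap.codRestrictOfInjective_comp_apply
    ((groupAlgebraHom N h.1).restrictScalars K ∘ₗ
      (cosetHom : L →ₐ[K] (GaloisCosets K L E → E)).toLinearMap)
    (cosetHom : L →ₐ[K] (GaloisCosets K L E → E)).toLinearMap cosetHom_injective
    (groupAlgebraHom_cosetHom_mem N hN h) x

/-- The action of `E[N]^G` on `L`. -/
def fixedAct (hN : (leftTranslation K L E).range ≤ Subgroup.normalizer (N : Set _)) :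
    fixedSubalgebra N hN →ₐ[K] Module.End K L :=
  AlgHom.ofLinearMap
    { toFun := fixedActAux N hN
      map_add' := fun a b => by
        ext x
        apply cosetHom_injective (K := K) (E := E)
        rw [LinearMap.add_apply, map_add]
        simp only [cosetHom_fixedActAux]
        simp
      map_smul' := fun c a => by
        ext x
        apply cosetHom_injective (K := K) (E := E)
        rw [LinearMap.smul_apply, map_smul]
        simp only [cosetHom_fixedActAux]
        ext y
        rw [RingHom.id_apply, Subalgebra.coe_smul, ← algebraMap_smul E c a.1, map_smul]
        simp [Algebra.smul_def] }
    (by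
      ext x
      apply cosetHom_injective (K := K) (E := E)
      exact (cosetHom_fixedActAux N hN 1 x).trans (by simp))
    (fun a b => by
      ext x
      apply cosetHom_injective (K := K) (E := E)
      refine (cosetHom_fixedActAux N hN (a * b) x).trans ?_
      refine Eq.trans ?_ (cosetHom_fixedActAux N hN a _).symm
      change _ = groupAlgebraHom N a.1 (cosetHom (fixedActAux N hN b x))
      rw [cosetHom_fixedActAux]
      simp)

theorem cosetHom_fixedAct
    (hN : (leftTranslation K L E).range ≤ Subgroup.normalizer (N : Set _))
    (h : fixedSubalgebra N hN) (x : L) :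
    (cosetHom (fixedAct N hN h x) : GaloisCosets K L E → E) =
      groupAlgebraHom N h.1 (cosetHom x) :=
  cosetHom_fixedActAux N hN h x

/-- Injectivity is inherited from the corresponding map over `E`; surjectivity follows by counting
dimensions, since regularity gives `N` as many elements as `G / G'`. -/
theorem bijective_lift_fixedAct (hreg : IsRegularSubgroup N)
    (hN : (leftTranslation K L E).range ≤ Subgroup.normalizer (N : Set _)) :
    Function.Bijective (TensorProduct.lift ((LinearMap.mul K (Module.End K L)).compl₁₂
      (Algebra.lmul K L).toLinearMap (fixedAct N hN).toLinearMap) :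
        L ⊗[K] fixedSubalgebra N hN →ₗ[K] Module.End K L) := by
  have hL := isForm_cosetHom (K := K) (L := L) (E := E)
  have hH := isForm_fixedSubalgebra N hN
  have := hL.finite
  have := hH.finite
  have hinj : Function.Injective (TensorProduct.lift ((LinearMap.mul K (Module.End K L)).compl₁₂
      (Algebra.lmul K L).toLinearMap (fixedAct N hN).toLinearMap) :
        L ⊗[K] fixedSubalgebra N hN →ₗ[K] Module.End K L) := by
    rw [injective_iff_map_eq_zero]
    intro t ht
    apply (hL.tensor hH).injective
    rw [map_zero]
    apply lift_groupAlgebraHom_injective N hreg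
    rw [map_zero]
    refine hL.ext fun x => ?_
    have key : ∀ t : L ⊗[K] fixedSubalgebra N hN,
        (cosetHom (TensorProduct.lift ((LinearMap.mul K (Module.End K L)).compl₁₂
          (Algebra.lmul K L).toLinearMap (fixedAct N hN).toLinearMap) t x) :
            GaloisCosets K L E → E) =
        TensorProduct.lift
          ((LinearMap.mul E (Module.End E (GaloisCosets K L E → E))).compl₁₂
            (Algebra.lmul E (GaloisCosets K L E → E)).toLinearMap
            (groupAlgebraHom N).toLinearMap)
          (formTensor E (cosetHom : L →ₐ[K] (GaloisCosets K L E → E)).toLinearMap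
            (fixedSubalgebra N hN).val.toLinearMap t) (cosetHom x) := by
      intro t
      induction t with
      | zero => simp
      | add x y hx hy => simp only [map_add, LinearMap.add_apply, hx, hy]
      | tmul y h => simp [cosetHom_fixedAct]
    refine (key t).symm.trans ?_
    rw [ht]
    simp
  refine ⟨hinj, ?_⟩
  refine (LinearMap.injective_iff_surjective_of_finrank_eq_finrank ?_).1 hinj
  have hcard : Nat.card N = Nat.card (GaloisCosets K L E) := by
    refine Nat.card_congr (Equiv.ofBijective
      (fun n : N => n.1 (QuotientGroup.mk (1 : E ≃ₐ[K] E))) ⟨fun a b h => ?_, fun y => ?_⟩)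
    · exact (hreg _ _).unique h rfl
    · exact (hreg _ y).exists
  rw [Module.finrank_tensorProduct, Module.finrank_linearMap, hL.finrank_eq, hH.finrank_eq,
    Module.finrank_eq_nat_card_basis (MonoidAlgebra.basis N E), hcard,
    Module.finrank_eq_nat_card_basis (Pi.basisFun E (GaloisCosets K L E))]

/-- The Hopf Galois structure attached to a regular subgroup normalized by `λ(G)`. -/
def ofRegular (hreg : IsRegularSubgroup N)
    (hN : (leftTranslation K L E).range ≤ Subgroup.normalizer (N : Set _)) :
    HopfGaloisStructure K L where
  H := fixedSubalgebra N hN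
  hopfAlgebra := (isHopfForm_fixedSubalgebra N hN).hopfAlgebra
  finite := (isForm_fixedSubalgebra N hN).finite
  cocomm := (isHopfForm_fixedSubalgebra N hN).isCocomm
  μ := fixedAct N hN
  map_one' h := by
    apply cosetHom_injective (K := K) (E := E)
    ext y
    refine (congrFun (cosetHom_fixedAct N hN h 1) y).trans ?_
    rw [map_one, groupAlgebraHom_one]
    refine ((isHopfForm_fixedSubalgebra N hN).algebraMap_descCounit h).symm.trans ?_
    exact (congrFun ((cosetHom (L := L) (E := E)).commutes
      ((isHopfForm_fixedSubalgebra N hN).descCounit h)) y).symm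
  map_mul' h x y := by
    apply cosetHom_injective (K := K) (E := E)
    refine (cosetHom_fixedAct N hN h (x * y)).trans ?_
    have key : ∀ t : fixedSubalgebra N hN ⊗[K] fixedSubalgebra N hN,
        (cosetHom (LinearMap.mul' K L (TensorProduct.map
          ((fixedAct N hN).toLinearMap.flip x) ((fixedAct N hN).toLinearMap.flip y) t)) :
            GaloisCosets K L E → E) =
        LinearMap.mul' E (GaloisCosets K L E → E)
          (TensorProduct.map ((groupAlgebraHom N).toLinearMap.flip (cosetHom x))
            ((groupAlgebraHom N).toLinearMap.flip (cosetHom y))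
              (formTensor E (fixedSubalgebra N hN).val.toLinearMap
                (fixedSubalgebra N hN).val.toLinearMap t)) := by
      intro t
      induction t with
      | zero => simp
      | add x y hx hy => simp only [map_add, hx, hy]
      | tmul a b => simp [cosetHom_fixedAct]
    refine Eq.trans ?_ (key _).symm
    rw [map_mul, groupAlgebraHom_mul]
    refine congrArg (fun t => LinearMap.mul' E (GaloisCosets K L E → E)
      (TensorProduct.map ((groupAlgebraHom N).toLinearMap.flip (cosetHom x))
        ((groupAlgebraHom N).toLinearMap.flip (cosetHom y)) t)) ?_
    exact ((isHopfForm_fixedSubalgebra N hN).formTensor_descComul h).symm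
  bijective := bijective_lift_fixedAct N hreg hN

theorem correspondsTo_ofRegular (hreg : IsRegularSubgroup N)
    (hN : (leftTranslation K L E).range ≤ Subgroup.normalizer (N : Set _)) :
    (ofRegular N hreg hN).CorrespondsTo N hN := by
  refine ⟨AlgEquiv.refl, fun h => ?_, fun h => ?_, fun h x => ?_⟩
  · exact ((isHopfForm_fixedSubalgebra N hN).algebraMap_descCounit h).symm
  · exact ((isHopfForm_fixedSubalgebra N hN).formTensor_descComul h).symm
  · have h1 := congrFun (cosetHom_fixedAct N hN h x) (QuotientGroup.mk 1)
    rw [groupAlgebraHom_apply] at h1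
    exact h1

end OfRegular

end HopfGaloisStructure

theorem hasHopfGaloisStructureOfType_of_regular {K L E : Type*} [Field K] [Field L] [Field E]
    [Algebra K L] [Algebra K E] [Algebra L E] [IsScalarTower K L E]
    [FiniteDimensional K L] [Algebra.IsSeparable K L] [IsNormalClosure K L E]
    {T : Type*} [Group T]
    (N : Subgroup (Equiv.Perm (HopfGaloisStructure.GaloisCosets K L E)))
    (hreg : HopfGaloisStructure.IsRegularSubgroup N)
    (hN : (HopfGaloisStructure.leftTranslation K L E).range ≤ Subgroup.normalizer (N : Set _))
    (hT : Nonempty (N ≃* T)) : HasHopfGaloisStructureOfType K L E T := by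
  have := IsNormalClosure.finiteDimensional K L E
  have := IsNormalClosure.isGalois K L E
  exact ⟨HopfGaloisStructure.ofRegular N hreg hN, N, hN, hreg,
    HopfGaloisStructure.correspondsTo_ofRegular N hreg hN, hT⟩

/-! ### Regular subgroups with the same normalizer -/

section RegularSubgroups

open HopfGaloisStructure

/-- Let `N` be a regular subgroup of `Sym(X)`, isomorphic to `Q`, and let a group `T` be identified
with `Q` as a set in such a way that its product is `t * t' = t · τ_t(t')`, where `τ_t` is an
automorphism of `Q`. Then, if `τ` is compatible with the holomorph of `Q`, some regular subgroup
isomorphic to `T` is normalized by the normalizer of `N`. -/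
theorem exists_regular_of_twist {X Q T : Type*} [Nonempty X] [Group Q] [Group T]
    (N : Subgroup (Equiv.Perm X)) (hreg : IsRegularSubgroup N) (e : N ≃* Q)
    (f : T ≃ Q) (τ : T →* MulAut Q) (hf : ∀ t t', f (t * t') = f t * τ t (f t'))
    (hcomm : ∀ (α : MulAut Q) t q, α (τ t q) = τ t (α q))
    (hτ : ∀ (α : MulAut Q) m t, τ (f.symm (m * α (f t) * (τ t m)⁻¹)) = τ t) :
    ∃ N' : Subgroup (Equiv.Perm X), IsRegularSubgroup N' ∧
      Subgroup.normalizer (N : Set (Equiv.Perm X)) ≤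
        Subgroup.normalizer (N' : Set (Equiv.Perm X)) ∧ Nonempty (N' ≃* T) := by
  obtain ⟨x₀⟩ := ‹Nonempty X›
  have hf1 : f 1 = 1 := by
    have h := hf 1 1
    rw [mul_one, map_one τ, MulAut.one_apply] at h
    exact left_eq_mul.1 h
  -- The orbit map of the base point; it turns the action of `N` into left translation on `Q`.
  let b : Q ≃ X := Equiv.ofBijective (fun q => (e.symm q).1 x₀)
    ⟨fun q q' h => e.symm.injective ((hreg _ _).unique h rfl), fun y => by
      obtain ⟨n, hn, -⟩ := hreg x₀ y
      exact ⟨e n, by simpa using hn⟩⟩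
  have hb : ∀ n q, (e.symm n).1 (b q) = b (n * q) := fun n q => by
    change (e.symm n).1 ((e.symm q).1 x₀) = (e.symm (n * q)).1 x₀
    rw [map_mul]
    rfl
  let Φ : T →* Equiv.Perm Q := MonoidHom.toHomPerm
    { toFun := fun t q => f t * τ t q
      map_one' := by
        funext q
        change f 1 * τ 1 q = q
        simp [hf1]
      map_mul' := fun t t' => by
        funext q
        change f (t * t') * τ (t * t') q = f t * τ t (f t' * τ t' q)
        simp [hf, mul_assoc] }
  have hΦ : ∀ t q, Φ t q = f t * τ t q := fun t q => rfl
  let Ψ : T →* Equiv.Perm X := b.permCongrHom.toMonoidHom.comp Φ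
  have hΨ : ∀ t q, Ψ t (b q) = b (f t * τ t q) := fun t q => by simp [Ψ, hΦ]
  have hbase : ∀ t, Ψ t (b 1) = b (f t) := fun t => by rw [hΨ, map_one, mul_one]
  have hconj : ∀ g ∈ Subgroup.normalizer (N : Set (Equiv.Perm X)), ∀ t, ∃ t',
      Ψ t' = g * Ψ t * g⁻¹ := by
    intro g hg t
    have hg' := Subgroup.mem_normalizer_iff.1 hg
    let α₀ : MulAut Q := (e.symm.trans (Subgroup.normalizerMonoidHom N ⟨g, hg⟩)).trans e
    have hα₀ : ∀ q, (e.symm (α₀ q)).1 = g * (e.symm q).1 * g⁻¹ := fun q => by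
      simp [α₀]
    obtain ⟨m, hm⟩ := b.surjective (g (b 1))
    -- Conjugation by `g` gives `g (b q) = b (α₀ q * m)`; correcting `α₀` by an inner automorphism
    -- moves `m` to the left.
    let α : MulAut Q := MulAut.conj m⁻¹ * α₀
    have hgb : ∀ q, g (b q) = b (m * α q) := by
      intro q
      have h1 : g (b q) = (e.symm (α₀ q)).1 (g (b 1)) := by
        have h2 : (e.symm q).1 (b 1) = b q := by rw [hb, mul_one]
        rw [hα₀, ← h2]
        simp
      rw [h1, ← hm, hb]
      simp [α, mul_assoc]
    -- Forced by comparing `m * α (f t * τ t q)` with `f t' * τ t' (m * α q)`, once `τ t' = τ t` and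
    -- `τ t` commutes with `α`.
    refine ⟨f.symm (m * α (f t) * (τ t m)⁻¹), ?_⟩
    rw [eq_mul_inv_iff_mul_eq]
    ext x
    obtain ⟨q, rfl⟩ := b.surjective x
    rw [Equiv.Perm.mul_apply, Equiv.Perm.mul_apply, hgb, hΨ, hΨ, hgb, hτ, Equiv.apply_symm_apply]
    simp [hcomm, mul_assoc]
  have hΨinj : Function.Injective Ψ := fun t t' h => by
    apply f.injective
    apply b.injective
    rw [← hbase, h, hbase]
  refine ⟨Ψ.range, ?_, ?_, ⟨(MonoidHom.ofInjective hΨinj).symm⟩⟩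
  · have hsimple : ∀ q q' : Q, ∃! t : T, Ψ t (b q) = b q' := by
      intro q q'
      refine ⟨f.symm q' * (f.symm q)⁻¹, ?_, fun t ht => ?_⟩
      · have h1 : b q = Ψ (f.symm q) (b 1) := by rw [hbase, Equiv.apply_symm_apply]
        simp only
        rw [h1, ← Equiv.Perm.mul_apply, ← map_mul, inv_mul_cancel_right, hbase,
          Equiv.apply_symm_apply]
      · have h1 : b q = Ψ (f.symm q) (b 1) := by rw [hbase, Equiv.apply_symm_apply]
        rw [h1, ← Equiv.Perm.mul_apply, ← map_mul, hbase] at ht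
        rw [eq_mul_inv_iff_mul_eq, ← b.injective ht, Equiv.symm_apply_apply]
    intro x y
    obtain ⟨q, rfl⟩ := b.surjective x
    obtain ⟨q', rfl⟩ := b.surjective y
    obtain ⟨t, ht, hu⟩ := hsimple q q'
    refine ⟨⟨Ψ t, t, rfl⟩, ht, ?_⟩
    rintro ⟨_, t', rfl⟩ ht'
    exact Subtype.ext (congrArg Ψ (hu t' ht'))
  · intro g hg
    rw [Subgroup.mem_normalizer_iff]
    intro h
    constructor
    · rintro ⟨t, rfl⟩
      exact hconj g hg t
    · rintro ⟨t, ht⟩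
      obtain ⟨t', ht'⟩ := hconj g⁻¹ (inv_mem hg) t
      exact ⟨t', by rw [ht', ht]; group⟩

/-- The action of `C₂` on `Z × D` whose generator acts on `Z` by inversion and on `D` trivially. -/
def inversionProdAction (Z D : Type*) [CommGroup Z] [Group D] : Cyc 2 →* MulAut (Z × D) where
  toFun c := MulEquiv.prodCongr (inversionAction Z c) (MulEquiv.refl D)
  map_one' := by rw [map_one]; rfl
  map_mul' a b := by rw [map_mul]; rfl

theorem inversionProdAction_apply {Z D : Type*} [CommGroup Z] [Group D] (c : Cyc 2) (x : Z × D) :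
    inversionProdAction Z D c x = (inversionAction Z c x.1, x.2) := rfl

theorem map_inversionAction {Z Z' : Type*} [CommGroup Z] [CommGroup Z'] (φ : Z →* Z') (c : Cyc 2)
    (z : Z) : φ (inversionAction Z c z) = inversionAction Z' c (φ z) := by
  by_cases h : c = 1 <;> simp [inversionAction, h]

/-- If the automorphisms of `Z × D` preserve both factors and the map `sgn` on `D`, the product of
`Z × D` may be twisted by the inversion of `Z` for elements of `D` with nontrivial sign. -/
theorem exists_regular_of_sign {X Z D T : Type*} [Nonempty X] [CommGroup Z] [Group D] [Group T]
    (N : Subgroup (Equiv.Perm X)) (hreg : IsRegularSubgroup N) (e : N ≃* Z × D)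
    (sgn : D →* Cyc 2) (f : T ≃ Z × D)
    (hf : ∀ t t', f (t * t') = f t * inversionProdAction Z D (sgn (f t).2) (f t'))
    (hZ : ∀ (α : MulAut (Z × D)) z, (α (z, 1)).2 = 1)
    (hD : ∀ (α : MulAut (Z × D)) d, (α (1, d)).1 = 1)
    (hsgn : ∀ (α : MulAut (Z × D)) d, sgn (α (1, d)).2 = sgn d) :
    ∃ N' : Subgroup (Equiv.Perm X), IsRegularSubgroup N' ∧
      Subgroup.normalizer (N : Set (Equiv.Perm X)) ≤
        Subgroup.normalizer (N' : Set (Equiv.Perm X)) ∧ Nonempty (N' ≃* T) := by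
  have hsplit : ∀ (α : MulAut (Z × D)) x, α x = ((α (x.1, 1)).1, (α (1, x.2)).2) := by
    intro α x
    conv_lhs => rw [show x = (x.1, 1) * (1, x.2) by simp, map_mul]
    ext <;> simp [hZ, hD]
  have hf1 : f 1 = 1 := by
    have := hf 1 1
    rw [mul_one, left_eq_mul] at this
    simpa using this
  let τ : T →* MulAut (Z × D) := (inversionProdAction Z D).comp
    { toFun := fun t => sgn (f t).2
      map_one' := by rw [hf1, Prod.snd_one, map_one]
      map_mul' := fun t t' => by
        rw [hf, Prod.snd_mul, map_mul, inversionProdAction_apply] }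
  have hτ : ∀ t, τ t = inversionProdAction Z D (sgn (f t).2) := fun t => rfl
  -- Inversion commutes with every homomorphism of commutative groups. The `D`-component of the
  -- conjugated element is a conjugate of `(α (1, d)).2`, where `d` is that of `f t`, so its sign is
  -- that of `d`.
  refine exists_regular_of_twist N hreg e f τ hf (fun α t q => ?_) fun α m t => ?_
  · rw [hτ, inversionProdAction_apply, inversionProdAction_apply, hsplit, hsplit α q]
    ext
    · exact map_inversionAction ((MonoidHom.fst Z D).comp
        (α.toMonoidHom.comp (MonoidHom.inl Z D))) _ _
    · rfl
  · rw [hτ, hτ, Equiv.apply_symm_apply, hsplit α (f t), inversionProdAction_apply]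
    simp [hsgn]

end RegularSubgroups

/-! ### Groups of order `2 p ^ 2` -/

section Groups

open HopfGaloisStructure

theorem Cyc.pow_eq_one {n : ℕ} (x : Cyc n) : x ^ n = 1 := by
  apply Multiplicative.toAdd.injective
  simp

theorem Cyc.two_cases (c : Cyc 2) : c = 1 ∨ c = Multiplicative.ofAdd 1 := by
  revert c
  decide

theorem eq_one_of_sq_eq_one_of_pow_eq_one {G : Type*} [Group G] {p : ℕ} (hp : Odd p) {x : G}
    (h2 : x ^ 2 = 1) (hx : x ^ p = 1) : x = 1 := by
  have := (pow_gcd_eq_one (a := x)).2 ⟨h2, hx⟩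
  rwa [(Nat.coprime_two_left.2 hp : Nat.gcd 2 p = 1), pow_one] at this

/-- The isomorphism `C_p × C_{2p} ≃ (C_p × C_p) × C₂`, for odd `p`. -/
def cycProdCycEquiv {p : ℕ} (hp : Odd p) : Cyc p × Cyc (2 * p) ≃* (Cyc p × Cyc p) × Cyc 2 :=
  ((MulEquiv.refl (Cyc p)).prodCongr
    ((ZMod.chineseRemainder (Nat.coprime_two_left.2 hp)).toAddEquiv.toMultiplicative.trans
      ((MulEquiv.prodMultiplicative (ZMod 2) (ZMod p)).trans MulEquiv.prodComm))).trans
    MulEquiv.prodAssoc.symm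

/-- Here `Z = C_p × C_p` and `D = C₂` have coprime exponents, so automorphisms preserve both; the
sign is the identity of `C₂`, whose only automorphism is trivial. -/
theorem exists_regular_of_cyc {X : Type*} [Nonempty X] {p : ℕ} (hp : Odd p)
    (N : Subgroup (Equiv.Perm X)) (hreg : IsRegularSubgroup N) (e : N ≃* Cyc p × Cyc (2 * p)) :
    ∃ N' : Subgroup (Equiv.Perm X), IsRegularSubgroup N' ∧
      Subgroup.normalizer (N : Set (Equiv.Perm X)) ≤
        Subgroup.normalizer (N' : Set (Equiv.Perm X)) ∧
      Nonempty (N' ≃* InversionSemidirect p) := by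
  have hZp : ∀ z : Cyc p × Cyc p, z ^ p = 1 := fun z => by
    ext1 <;> exact Cyc.pow_eq_one _
  have hD : ∀ (α : MulAut ((Cyc p × Cyc p) × Cyc 2)) d, (α (1, d)).1 = 1 := fun α d => by
    refine eq_one_of_sq_eq_one_of_pow_eq_one hp ?_ (hZp _)
    rw [← Prod.pow_fst, ← map_pow, Prod.pow_mk, one_pow, Cyc.pow_eq_one]
    exact congrArg Prod.fst (map_one α)
  refine exists_regular_of_sign N hreg (e.trans (cycProdCycEquiv hp)) (MonoidHom.id (Cyc 2))
    SemidirectProduct.equivProd (fun t t' => rfl) (fun α z => ?_) hD fun α d => ?_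
  · refine eq_one_of_sq_eq_one_of_pow_eq_one hp (Cyc.pow_eq_one _) ?_
    rw [← Prod.pow_snd, ← map_pow, Prod.pow_mk, one_pow, hZp]
    exact congrArg Prod.snd (map_one α)
  · change (α (1, d)).2 = d
    have h : d ≠ 1 → (α (1, d)).2 ≠ 1 := fun hd h => hd <| by
      have h1 : α (1, d) = α 1 := by
        rw [map_one]
        exact Prod.ext (hD α d) h
      exact congrArg Prod.snd (α.injective h1)
    rcases Cyc.two_cases d with rfl | rfl
    · exact congrArg Prod.snd (map_one α)
    · exact (Cyc.two_cases _).resolve_left (h (by decide))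

/-- The sign of an element of the dihedral group, trivial on rotations only. -/
def dihedralSign (p : ℕ) : DihedralGroup p →* Cyc 2 where
  toFun
    | .r _ => 1
    | .sr _ => Multiplicative.ofAdd 1
  map_one' := rfl
  map_mul' := by
    rintro (i | i) (j | j)
    · rfl
    · rfl
    · rfl
    · exact show (1 : Cyc 2) = Multiplicative.ofAdd 1 * Multiplicative.ofAdd 1 by decide

@[simp]
theorem dihedralSign_r {p : ℕ} (i : ZMod p) : dihedralSign p (.r i) = 1 := rfl

@[simp]
theorem dihedralSign_sr {p : ℕ} (i : ZMod p) :
    dihedralSign p (.sr i) = Multiplicative.ofAdd 1 := rfl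

/-- Describing the sign by a power makes it visibly invariant under automorphisms. -/
theorem dihedralSign_eq_one_iff {p : ℕ} (hp : Odd p) (d : DihedralGroup p) :
    dihedralSign p d = 1 ↔ d ^ p = 1 := by
  rcases d with i | i
  · refine iff_of_true rfl ?_
    rw [DihedralGroup.r_pow]
    simp
  · refine iff_of_false (show (Multiplicative.ofAdd 1 : Cyc 2) ≠ 1 by decide) fun h => ?_
    have h2 : DihedralGroup.sr i ^ 2 = 1 := by rw [sq, DihedralGroup.sr_mul_self]
    have := eq_one_of_sq_eq_one_of_pow_eq_one hp h2 h
    cases this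

/-- The bijection from `(C_p × C_p) ⋊ C₂` to `C_p × D_{2p}` which maps `((a, b), c)` to `(a, b c)`,
where `b` is a rotation and `c` a power of a reflection. -/
def inversionSemidirectEquiv (p : ℕ) : InversionSemidirect p ≃ Cyc p × DihedralGroup p where
  -- The minus sign comes from `r b * sr 0 = sr (-b)`.
  toFun t := (t.left.1, if t.right = 1 then .r t.left.2.toAdd else .sr (-t.left.2.toAdd))
  invFun
    | (a, .r i) => ⟨(a, Multiplicative.ofAdd i), 1⟩
    | (a, .sr i) => ⟨(a, Multiplicative.ofAdd (-i)), Multiplicative.ofAdd 1⟩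
  left_inv := by
    rintro ⟨⟨a, b⟩, c⟩
    rcases Cyc.two_cases c with rfl | rfl
    · simp
    · simp
  right_inv := by
    rintro ⟨a, i | i⟩
    · simp
    · simp

theorem inversionAction_one {A : Type*} [CommGroup A] (a : A) : inversionAction A 1 a = a := by
  rw [map_one, MulAut.one_apply]

theorem inversionAction_ofAdd_one {A : Type*} [CommGroup A] (a : A) :
    inversionAction A (Multiplicative.ofAdd 1) a = a⁻¹ := rfl

theorem inversionSemidirectEquiv_mk_one {p : ℕ} (x : Cyc p × Cyc p) :
    inversionSemidirectEquiv p ⟨x, 1⟩ = (x.1, .r x.2.toAdd) := rfl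

theorem inversionSemidirectEquiv_mk_ofAdd_one {p : ℕ} (x : Cyc p × Cyc p) :
    inversionSemidirectEquiv p ⟨x, Multiplicative.ofAdd 1⟩ = (x.1, .sr (-x.2.toAdd)) := rfl

/-- A reflection already inverts the rotations in `D_{2p}`; the twist makes it invert the factor
`C_p` as well. -/
theorem inversionSemidirectEquiv_mul (p : ℕ) (t t' : InversionSemidirect p) :
    inversionSemidirectEquiv p (t * t') = inversionSemidirectEquiv p t *
      inversionProdAction (Cyc p) (DihedralGroup p)
        (dihedralSign p (inversionSemidirectEquiv p t).2) (inversionSemidirectEquiv p t') := by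
  have h11 : (Multiplicative.ofAdd 1 * Multiplicative.ofAdd 1 : Cyc 2) = 1 := by decide
  obtain ⟨x, c⟩ := t
  obtain ⟨x', c'⟩ := t'
  rw [SemidirectProduct.mul_def]
  rcases Cyc.two_cases c with rfl | rfl <;> rcases Cyc.two_cases c' with rfl | rfl <;>
    simp only [one_mul, mul_one, h11, inversionAction_one, inversionAction_ofAdd_one,
      inversionSemidirectEquiv_mk_one, inversionSemidirectEquiv_mk_ofAdd_one,
      inversionProdAction_apply, dihedralSign_r, dihedralSign_sr, Prod.mk_mul_mk, Prod.fst_mul,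
      Prod.snd_mul, Prod.fst_inv, Prod.snd_inv, toAdd_mul, toAdd_inv, DihedralGroup.r_mul_r,
      DihedralGroup.r_mul_sr, DihedralGroup.sr_mul_r, DihedralGroup.sr_mul_sr, neg_add, neg_neg,
      sub_eq_add_neg, add_comm]

theorem exists_regular_of_dihedral {X : Type*} [Nonempty X] {p : ℕ} (hp : Odd p) (hp1 : p ≠ 1)
    (N : Subgroup (Equiv.Perm X)) (hreg : IsRegularSubgroup N) (e : N ≃* Cyc p × DihedralGroup p) :
    ∃ N' : Subgroup (Equiv.Perm X), IsRegularSubgroup N' ∧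
      Subgroup.normalizer (N : Set (Equiv.Perm X)) ≤
        Subgroup.normalizer (N' : Set (Equiv.Perm X)) ∧
      Nonempty (N' ≃* InversionSemidirect p) := by
  have hD : ∀ (α : MulAut (Cyc p × DihedralGroup p)) d, (α (1, d)).1 = 1 := fun α => by
    have hsr : ∀ i, (α (1, .sr i)).1 = 1 := fun i => by
      refine eq_one_of_sq_eq_one_of_pow_eq_one hp ?_ (Cyc.pow_eq_one _)
      rw [← Prod.pow_fst, ← map_pow, Prod.pow_mk, one_pow, sq, DihedralGroup.sr_mul_self]
      exact congrArg Prod.fst (map_one α)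
    rintro (i | i)
    -- Rotations are products of two reflections, and the involutions `(1, sr i)` have images with
    -- trivial component in `C_p`, a group of odd exponent.
    · have : ((1, .r i) : Cyc p × DihedralGroup p) = (1, .sr 0) * (1, .sr i) := by simp
      rw [this, map_mul, Prod.fst_mul, hsr, hsr, one_mul]
    · exact hsr i
  refine exists_regular_of_sign N hreg e (dihedralSign p) (inversionSemidirectEquiv p)
    (inversionSemidirectEquiv_mul p) (fun α z => ?_) hD fun α d => ?_
  -- The elements `(z, 1)` are central, hence so are their images, and `D_{2p}` has trivial centre.
  · rw [← Subgroup.mem_bot, ← DihedralGroup.center_eq_bot_of_odd_ne_one hp hp1,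
      Subgroup.mem_center_iff]
    intro d
    obtain ⟨⟨z', d'⟩, h⟩ := α.surjective (1, d)
    have h1 : α (z', d') * α (z, 1) = α (z, 1) * α (z', d') := by
      rw [← map_mul, ← map_mul, Prod.mk_mul_mk, Prod.mk_mul_mk, mul_comm, one_mul, mul_one]
    rw [h] at h1
    exact congrArg Prod.snd h1
  · have h : dihedralSign p (α (1, d)).2 = 1 ↔ dihedralSign p d = 1 := by
      rw [dihedralSign_eq_one_iff hp, dihedralSign_eq_one_iff hp]
      have h1 : α (1, d) ^ p = 1 ↔ ((1, d) : Cyc p × DihedralGroup p) ^ p = 1 := by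
        rw [← map_pow, map_eq_one_iff _ α.injective]
      rw [Prod.ext_iff, Prod.ext_iff] at h1
      simpa [hD] using h1
    rcases Cyc.two_cases (dihedralSign p d) with h0 | h0
    · rw [h0, h.2 h0]
    · rw [h0]
      refine (Cyc.two_cases _).resolve_left fun h' => ?_
      rw [h.1 h'] at h0
      revert h0
      decide

end Groups

end

theorem mainTheorem3 {K L E : Type*} [Field K] [Field L] [Field E]
    [Algebra K L] [Algebra K E] [Algebra L E] [IsScalarTower K L E]
    [FiniteDimensional K L] [Algebra.IsSeparable K L] [IsNormalClosure K L E]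
    (p : ℕ) (hp : p.Prime) (hp2 : p ≠ 2) (hdeg : Module.finrank K L = 2 * p ^ 2)
    (h : HasHopfGaloisStructureOfType K L E (Cyc p × Cyc (2 * p)) ∨
      HasHopfGaloisStructureOfType K L E (Cyc p × DihedralGroup p)) :
    HasHopfGaloisStructureOfType K L E (InversionSemidirect p) := by
  have hodd : Odd p := hp.odd_of_ne_two hp2
  -- Only the regular subgroup `N` of the given structure matters, not its Hopf algebra.
  rcases h with ⟨-, N, hN, hreg, -, ⟨e⟩⟩ | ⟨-, N, hN, hreg, -, ⟨e⟩⟩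
  · obtain ⟨N', hreg', hN', hT⟩ := exists_regular_of_cyc hodd N hreg e
    exact hasHopfGaloisStructureOfType_of_regular N' hreg' (hN.trans hN') hT
  · obtain ⟨N', hreg', hN', hT⟩ := exists_regular_of_dihedral hodd hp.ne_one N hreg e
    exact hasHopfGaloisStructureOfType_of_regular N' hreg' (hN.trans hN') hT
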